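/- Let $\omega=\frac{-1+\sqrt{-3}}{2}$, $\mathcal{E}=\mathbb{Z}[\omega]$ and $\theta=\omega-\bar\omega=\sqrt{-3}$, so that $\mathcal{E}/\theta\mathcal{E}\cong\mathbb{F}_3$. An $\mathcal{E}$-lattice of signature $(p,n)$ is a free $\mathcal{E}$-module $L$ of finite rank with an $\mathcal{E}$-valued Hermitian form $\langle\,,\rangle$, linear in its first argument, that is nondegenerate of signature $(p,n)$ on $L\otimes\mathbb{C}$; its dual is $L'=\{v\in L\otimes\mathbb{C} : \langle L,v\rangle\subseteq\mathcal{E}\}$. Write $L_{13,1}$ for the $\mathcal{E}$-lattice that is characterized by having signature $(13,1)$ and satisfying $L_{13,1}=\theta L_{13,1}'$; that is, a lattice is isomorphic to $L_{13,1}$ when it has these two properties. In $\mathbb{F}_3^{13}$, with coordinates indexed by the points of the projective plane $P^2(\mathbb{F}_3)$, let $\mathcal{C}$ be the span of the differences of characteristic functions of lines, and let $\mathcal{C}^\perp$ (the line code) be its orthogonal complement under the usual inner product. On $\mathbb{C}^{14}$, with the last 13 coordinates indexed by the points of $P^2(\mathbb{F}_3)$, use the form $$\langle x,y\rangle=-x_0\bar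 y_0+x_1\bar y_1+\dots+x_{13}\bar y_{13}.$$ Let $L$ be the set of vectors $(x_0;x_1,\dots,x_{13})\in\mathcal{E}^{14}$ such that $(x_1,\dots,x_{13})$ reduces modulo $\theta$ to an element of $\mathcal{C}^\perp$ and $x_0\equiv x_1+\dots+x_{13}\pmod\theta$. Theorem. $L$ is isomorphic to $L_{13,1}$; that is, $L$ is an $\mathcal{E}$-lattice of signature $(13,1)$ and $L=\theta L'$. Moreover $L$ is spanned over $\mathcal{E}$ by the $13$ point roots $(0;\theta,0^{12})$, with the $\theta$ in any of the last $13$ spots, and the $13$ line roots $(1;1^4,0^9)$, with the $1$'s along a line of $P^2(\mathbb{F}_3)$ (each line has $4$ points). All of these are roots of $L$, i.e. vectors of $L$ of norm $\langle r,r\rangle=3$. -/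

import Mathlib

open scoped ComplexConjugate Pointwise

noncomputable section

namespace EisensteinModel

/-- The primitive cube root of unity `ω = (-1 + √-3) / 2`. -/
def ω : ℂ := ⟨-1 / 2, Real.sqrt 3 / 2⟩

/-- `θ = ω - ω̄ = √-3`. -/
def θ : ℂ := ω - conj ω

/-- The ring `ℤ[ω]` of Eisenstein integers, as a subring of `ℂ`. -/
def Eis : Subalgebra ℤ ℂ := Algebra.adjoin ℤ {ω}

theorem ω_mem : ω ∈ Eis := Algebra.subset_adjoin rfl

theorem conj_ω : conj ω = -1 - ω := by
  apply Complex.ext <;> simp [ω]; norm_num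

theorem ω_sq : ω * ω = -1 - ω := by
  have h : Real.sqrt 3 * Real.sqrt 3 = 3 := Real.mul_self_sqrt (by norm_num)
  apply Complex.ext
  · simp [ω]; linarith
  · simp [ω]; ring

theorem ω_eq : ω = 1 + θ * (1 + ω) := by
  rw [θ, conj_ω]
  linear_combination (-2 : ℂ) * ω_sq

/-! ### Eisenstein lattices -/

section Lattice

variable {V : Type*} [AddCommGroup V] [Module ℂ V]

/-- A sesquilinear form, linear in the first and antilinear in the second variable, is Hermitian. -/
def IsHermitianForm (B : V →ₗ[ℂ] V →ₗ⋆[ℂ] ℂ) : Prop :=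
  ∀ x y, conj (B x y) = B y x

/-- `L` is an Eisenstein lattice of finite rank in the Hermitian space `(V, B)`, with
`V = L ⊗ ℂ`: it is the `ℤ[ω]`-span of a `ℂ`-basis of `V` (so it is free over `ℤ[ω]`),
and the form is `ℤ[ω]`-valued on `L`. -/
structure IsEisensteinLattice (B : V →ₗ[ℂ] V →ₗ⋆[ℂ] ℂ) (L : Submodule Eis V) : Prop where
  hermitian : IsHermitianForm B
  free : ∃ (n : ℕ) (b : Module.Basis (Fin n) ℂ V), L = Submodule.span Eis (Set.range b)
  integral : ∀ x ∈ L, ∀ y ∈ L, B x y ∈ Eis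

/-- The form is nondegenerate of signature `(p, n)`: in a suitable basis it is diagonal with `p`
entries `1` and `n` entries `-1`. -/
def HasSignature (B : V →ₗ[ℂ] V →ₗ⋆[ℂ] ℂ) (p n : ℕ) : Prop :=
  ∃ b : Module.Basis (Fin p ⊕ Fin n) ℂ V,
    (∀ i, B (b (Sum.inl i)) (b (Sum.inl i)) = 1) ∧
    (∀ j, B (b (Sum.inr j)) (b (Sum.inr j)) = -1) ∧
    ∀ s t, s ≠ t → B (b s) (b t) = 0

/-- The dual lattice `L' = {v ∈ L ⊗ ℂ : ⟨L, v⟩ ⊆ ℤ[ω]}`. -/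
def dual (B : V →ₗ[ℂ] V →ₗ⋆[ℂ] ℂ) (L : Submodule Eis V) : Set V :=
  {v | ∀ x ∈ L, B x v ∈ Eis}

/-- `L` is a copy of `L_{13,1}`, that is, an Eisenstein lattice of signature `(13,1)` with
`L = θ L'`. -/
structure IsL131 (B : V →ₗ[ℂ] V →ₗ⋆[ℂ] ℂ) (L : Submodule Eis V) : Prop where
  lattice : IsEisensteinLattice B L
  signature : HasSignature B 13 1
  eq_theta_dual : (L : Set V) = θ • dual B L

/-- A root of `L` is a vector of `L` of norm `3`. -/
def IsRoot (B : V →ₗ[ℂ] V →ₗ⋆[ℂ] ℂ) (L : Submodule Eis V) (r : V) : Prop :=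
  r ∈ L ∧ B r r = 3

end Lattice

/-! ### The projective plane over `𝔽₃` and its codes -/

/-- The field with three elements. -/
abbrev F3 : Type := ZMod 3

/-- The points of the projective plane over `𝔽₃`. -/
abbrev Pt : Type := Projectivization F3 (Fin 3 → F3)

/-- The lines of the projective plane over `𝔽₃`, in dual homogeneous coordinates: the line with
coordinates `[a : b : c]` is given by `a x + b y + c z = 0`. -/
abbrev Line : Type := Projectivization F3 (Fin 3 → F3)

instance : Fintype Pt := Fintype.ofFinite _

instance : DecidableEq Pt := Classical.decEq _

/-- The set of points on a line. -/
def Line.points (l : Line) : Set Pt := {p | Projectivization.orthogonal p l}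

/-- The characteristic function of a line, with values in `R`. -/
def lineVec (R : Type*) [Zero R] [One R] (l : Line) : Pt → R :=
  (Line.points l).indicator 1

/-- The line difference code `C`, spanned by the differences of lines. -/
def lineDiffCode : Submodule F3 (Pt → F3) :=
  Submodule.span F3 {c | ∃ l m : Line, c = lineVec F3 l - lineVec F3 m}

/-- The line code `C^⊥`, the orthogonal complement of `C` under the usual inner product. -/
def lineCode : Submodule F3 (Pt → F3) where
  carrier := {c | ∀ d ∈ lineDiffCode, ∑ p, c p * d p = 0}
  zero_mem' := by intro d _; simp
  add_mem' := by
    intro a b ha hb d hd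
    simp only [Pi.add_apply, add_mul, Finset.sum_add_distrib, ha d hd, hb d hd, add_zero]
  smul_mem' := by
    intro k a ha d hd
    simp only [Pi.smul_apply, smul_eq_mul, mul_assoc, ← Finset.mul_sum, ha d hd, mul_zero]

/-! ### The lattice -/

/-- The ambient space `ℂ^14`; its vectors are written `(x₀; x_p)`, with `p` running through the
points of the projective plane over `𝔽₃`. -/
abbrev C14 : Type := ℂ × (Pt → ℂ)

/-- The Hermitian form `⟨x, y⟩ = -x₀ ȳ₀ + ∑ x_p ȳ_p`. -/
def form : C14 →ₗ[ℂ] C14 →ₗ⋆[ℂ] ℂ :=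
  LinearMap.mk₂'ₛₗ (RingHom.id ℂ) (starRingEnd ℂ)
    (fun x y => -(x.1 * conj y.1) + ∑ p, x.2 p * conj (y.2 p))
    (by intro x x' y; simp [add_mul, Finset.sum_add_distrib]; ring)
    (by intro a x y; simp [mul_add, Finset.mul_sum, mul_assoc])
    (by intro x y y'; simp [mul_add, Finset.sum_add_distrib]; ring)
    (by
      intro a x y
      simp only [Prod.smul_fst, Prod.smul_snd, Pi.smul_apply, smul_eq_mul, map_mul, mul_add,
        Finset.mul_sum, mul_neg]
      congr 1
      · ring
      · exact Finset.sum_congr rfl fun p _ => by ring)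

/-- Congruence modulo `θ ℤ[ω]`. -/
def CongrModθ (x y : ℂ) : Prop := ∃ e ∈ Eis, x - y = θ * e

/-- The residue of `x` modulo `θ` is the element `c` of `𝔽₃ = ℤ/3 = ℤ[ω]/θℤ[ω]`. -/
def ReducesTo (x : ℂ) (c : F3) : Prop := ∃ n : ℤ, (n : F3) = c ∧ CongrModθ x n

theorem exists_int_congr {a : ℂ} (ha : a ∈ Eis) : ∃ n : ℤ, CongrModθ a n := by
  induction ha using Algebra.adjoin_induction with
  | mem x hx =>
    rw [Set.mem_singleton_iff] at hx
    subst hx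
    exact ⟨1, 1 + ω, Eis.add_mem Eis.one_mem ω_mem, by
      have := ω_eq
      push_cast
      linear_combination this⟩
  | algebraMap r => exact ⟨r, 0, Eis.zero_mem, by simp⟩
  | add x y _ _ hx hy =>
    obtain ⟨m, e, he, h⟩ := hx
    obtain ⟨n, f, hf, h'⟩ := hy
    exact ⟨m + n, e + f, Eis.add_mem he hf, by push_cast; linear_combination h + h'⟩
  | mul x y hxE hyE hx hy =>
    obtain ⟨m, e, he, h⟩ := hx
    obtain ⟨n, f, hf, h'⟩ := hy
    refine ⟨m * n, e * y + m * f, Eis.add_mem (Eis.mul_mem he hyE)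
      (Eis.mul_mem (intCast_mem Eis m) hf), ?_⟩
    push_cast
    linear_combination y * h + m * h'

theorem ReducesTo.add {x y : ℂ} {c d : F3} (hx : ReducesTo x c) (hy : ReducesTo y d) :
    ReducesTo (x + y) (c + d) := by
  obtain ⟨m, rfl, e, he, h⟩ := hx
  obtain ⟨n, rfl, f, hf, h'⟩ := hy
  exact ⟨m + n, by push_cast; rfl, e + f, Eis.add_mem he hf, by
    push_cast; linear_combination h + h'⟩

theorem ReducesTo.mul {x y : ℂ} {c d : F3} (hxE : x ∈ Eis) (hx : ReducesTo x c)
    (hy : ReducesTo y d) : ReducesTo (x * y) (c * d) := by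
  obtain ⟨m, rfl, e, he, h⟩ := hx
  obtain ⟨n, rfl, f, hf, h'⟩ := hy
  refine ⟨m * n, by push_cast; rfl, x * f + n * e, Eis.add_mem (Eis.mul_mem hxE hf)
      (Eis.mul_mem (intCast_mem Eis n) he), ?_⟩
  push_cast
  linear_combination x * h' + n * h

/-- The lattice `L`: the vectors `(x₀; x_p)` in `ℤ[ω]^14` such that `(x_p)` reduces modulo `θ` to
an element of the line code and `x₀ ≡ ∑ x_p` modulo `θ`. -/
def model : Submodule Eis C14 where
  carrier := {x | x.1 ∈ Eis ∧ (∀ p, x.2 p ∈ Eis) ∧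
    (∃ c ∈ lineCode, ∀ p, ReducesTo (x.2 p) (c p)) ∧ CongrModθ x.1 (∑ p, x.2 p)}
  zero_mem' := ⟨Eis.zero_mem, fun _ => Eis.zero_mem,
    ⟨0, lineCode.zero_mem, fun _ => ⟨0, by simp, 0, Eis.zero_mem, by simp⟩⟩,
    0, Eis.zero_mem, by simp⟩
  add_mem' := by
    rintro x y ⟨hx, hx', ⟨c, hc, hxc⟩, e, he, h⟩ ⟨hy, hy', ⟨d, hd, hyd⟩, f, hf, h'⟩
    refine ⟨Eis.add_mem hx hy, fun p => Eis.add_mem (hx' p) (hy' p),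
      ⟨c + d, lineCode.add_mem hc hd, fun p => (hxc p).add (hyd p)⟩, e + f, Eis.add_mem he hf, ?_⟩
    simp only [Prod.fst_add, Prod.snd_add, Pi.add_apply, Finset.sum_add_distrib]
    linear_combination h + h'
  smul_mem' := by
    rintro ⟨a, ha⟩ x ⟨hx, hx', ⟨c, hc, hxc⟩, e, he, h⟩
    obtain ⟨n, hn⟩ := exists_int_congr ha
    refine ⟨Eis.mul_mem ha hx, fun p => Eis.mul_mem ha (hx' p),
      ⟨(n : F3) • c, lineCode.smul_mem _ hc,
        fun p => ReducesTo.mul ha ⟨n, rfl, hn⟩ (hxc p)⟩, a * e, Eis.mul_mem ha he, ?_⟩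
    change a * x.1 - ∑ p, a * x.2 p = θ * (a * e)
    rw [← Finset.mul_sum]
    linear_combination a * h

/-- The point root `(0; θ, 0^12)`, with the `θ` at the point `p`. -/
def pointRoot (p : Pt) : C14 := (0, Pi.single p θ)

/-- The line root `(1; 1^4, 0^9)`, with the `1`s along the line `l`. -/
def lineRoot (l : Line) : C14 := (1, lineVec ℂ l)

end EisensteinModel

end

open scoped ComplexConjugate Pointwise

noncomputable section

namespace EisensteinModel

/-! ### Incidences in the projective plane over `𝔽₃` -/

/-! Everything rests on two facts about the plane of order 3: a line has 4 points and two distinct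
lines share one. Since 4 ≡ 1 mod 3, any two lines, equal or not, have inner product 1 over `F3`, so
lines lie in the line code.

They span it (`lineSpan_eq_lineCode`) by a dimension count. The difference code has dimension at
least 6, as it contains the squares of all nonzero linear forms, and it is strictly smaller than the
span of the lines. So that span has dimension at least 7, while the orthogonal complement has
dimension at most 13 - 6.

Generation follows: integral combinations of line roots realize every codeword, leaving a remainder
in θℰ^14, which the roots span (`mul_θ_mem_rootSpan`).

For L = θL', inner products of roots are divisible by θ, hence so are all those on L. Conversely,
for v in L', pairing with point roots makes the last 13 coordinates of θv integral, and pairing with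
line roots makes each line sum congruent to coordinate 0. These congruences force membership in L
(`mem_model_of_line_sums`). Freeness holds because ℰ is a principal ideal domain. -/

theorem card_pt : Fintype.card Pt = 13 := by
  rw [← Nat.card_eq_fintype_card, Projectivization.card'']
  simp

theorem order_plane : Configuration.ProjectivePlane.order Pt Line = 3 := by
  have h := Configuration.ProjectivePlane.card_points Pt Line
  rw [card_pt] at h
  generalize Configuration.ProjectivePlane.order Pt Line = n at h
  have : n < 4 := by nlinarith
  interval_cases n <;> omega

theorem ncard_points (l : Line) : (Line.points l).ncard = 4 := by
  have h := Configuration.ProjectivePlane.pointCount_eq Pt l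
  rw [order_plane] at h
  rw [← Nat.card_coe_set_eq]
  exact h

theorem lineVec_apply (R : Type*) [Zero R] [One R] (l : Line) (p : Pt)
    [Decidable (p ∈ Line.points l)] :
    lineVec R l p = if p ∈ Line.points l then 1 else 0 := by
  simp [lineVec, Set.indicator_apply]

theorem mem_points_comm (p q : Pt) : p ∈ Line.points q ↔ q ∈ Line.points p :=
  Projectivization.orthogonal_comm

/-- Points and lines share the same homogeneous coordinates, so incidence is symmetric. Each count
over points therefore gives the dual count over lines. -/
theorem lineVec_comm (R : Type*) [Zero R] [One R] (p q : Pt) : lineVec R p q = lineVec R q p := by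
  classical
  simp only [lineVec_apply, mem_points_comm p q]

theorem sum_lineVec (R : Type*) [CommRing R] (l : Line) : ∑ p, lineVec R l p = 4 := by
  classical
  have h := ncard_points l
  rw [Set.ncard_eq_toFinset_card'] at h
  simp only [lineVec_apply, Finset.sum_boole]
  have : (Finset.univ.filter fun p => p ∈ Line.points l) = (Line.points l).toFinset := by
    ext; simp
  rw [this, h]
  norm_num

theorem exists_mem_points_inter {l m : Line} (h : l ≠ m) :
    ∃ p, ∀ q, q ∈ Line.points l ∧ q ∈ Line.points m ↔ q = p := by
  refine ⟨Projectivization.cross l m, fun q => ⟨fun hq => ?_, ?_⟩⟩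
  · exact (Configuration.ofField.eq_or_eq_of_orthogonal hq.1
      (Projectivization.cross_orthogonal_left h) hq.2
      (Projectivization.cross_orthogonal_right h)).resolve_right h
  · rintro rfl
    exact ⟨Projectivization.cross_orthogonal_left h, Projectivization.cross_orthogonal_right h⟩

theorem sum_lineVec_mul (R : Type*) [CommRing R] (l m : Line) :
    ∑ p, lineVec R l p * lineVec R m p = if l = m then 4 else 1 := by
  classical
  split_ifs with h
  · subst h
    rw [← sum_lineVec R l]
    refine Finset.sum_congr rfl fun p _ => ?_
    rw [lineVec_apply]
    split_ifs <;> simp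
  · obtain ⟨p, hp⟩ := exists_mem_points_inter h
    have : ∀ q, lineVec R l q * lineVec R m q = if q = p then 1 else 0 := fun q => by
      rw [lineVec_apply, lineVec_apply, ite_zero_mul_ite_zero, mul_one]
      simp only [hp]
    simp [this]

theorem sum_lines_mul (R : Type*) [CommRing R] (p q : Pt) :
    ∑ l, lineVec R l p * lineVec R l q = if p = q then 4 else 1 := by
  simp only [← sum_lineVec_mul R p q, lineVec_comm R _ p, lineVec_comm R _ q]

theorem lineVec_injective (R : Type*) [CommRing R] [CharZero R] :
    Function.Injective (lineVec R) := by
  intro l m h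
  by_contra hne
  have h1 := sum_lineVec_mul R l m
  rw [h, sum_lineVec_mul, if_pos rfl, if_neg hne] at h1
  norm_num at h1

/-! ### The line code -/

theorem sum_lineVec_mul_F3 (l m : Line) : ∑ p, lineVec F3 l p * lineVec F3 m p = 1 := by
  rw [sum_lineVec_mul]
  split_ifs <;> decide

theorem mem_lineCode_iff {c : Pt → F3} :
    c ∈ lineCode ↔ ∀ l m, ∑ p, c p * lineVec F3 l p = ∑ p, c p * lineVec F3 m p := by
  constructor
  · intro h l m
    have := h _ (Submodule.subset_span ⟨l, m, rfl⟩)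
    simpa [mul_sub, sub_eq_zero] using this
  · intro h d hd
    induction hd using Submodule.span_induction with
    | mem d hd =>
      obtain ⟨l, m, rfl⟩ := hd
      simpa [mul_sub, sub_eq_zero] using h l m
    | zero => simp
    | add x y _ _ hx hy => simp [mul_add, Finset.sum_add_distrib, hx, hy]
    | smul a x _ hx =>
      simp only [Pi.smul_apply, smul_eq_mul, mul_left_comm _ a, ← Finset.mul_sum, hx, mul_zero]

/-- The code spanned by the lines. -/
def lineSpan : Submodule F3 (Pt → F3) := Submodule.span F3 (Set.range (lineVec F3))

theorem lineVec_mem_lineCode (l : Line) : lineVec F3 l ∈ lineCode :=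
  mem_lineCode_iff.2 fun m n => by rw [sum_lineVec_mul_F3, sum_lineVec_mul_F3]

theorem lineSpan_le_lineCode : lineSpan ≤ lineCode :=
  Submodule.span_le.2 <| by rintro _ ⟨l, rfl⟩; exact lineVec_mem_lineCode l

theorem sum_eq_zero_of_mem_lineDiffCode {c : Pt → F3} (hc : c ∈ lineDiffCode) :
    ∑ p, c p = 0 := by
  induction hc using Submodule.span_induction with
  | mem d hd =>
    obtain ⟨l, m, rfl⟩ := hd
    simp [sum_lineVec]
  | zero => simp
  | add x y _ _ hx hy => simp [Finset.sum_add_distrib, hx, hy]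
  | smul a x _ hx => simp [← Finset.mul_sum, hx]

/-- The coordinate sum vanishes on differences of lines but equals 4 = 1 on a line. -/
theorem lineDiffCode_lt_lineSpan : lineDiffCode < lineSpan := by
  refine lt_of_le_of_ne (Submodule.span_le.2 ?_) fun h => ?_
  · rintro _ ⟨l, m, rfl⟩
    exact sub_mem (Submodule.subset_span ⟨l, rfl⟩) (Submodule.subset_span ⟨m, rfl⟩)
  · obtain ⟨l⟩ : Nonempty Line := inferInstance
    have hl : lineVec F3 l ∈ lineSpan := Submodule.subset_span ⟨l, rfl⟩
    rw [← h] at hl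
    have := sum_eq_zero_of_mem_lineDiffCode hl
    rw [sum_lineVec] at this
    exact absurd this (by decide)

theorem sum_lines (R : Type*) [CommRing R] (p : Pt) : ∑ l, lineVec R l p = 4 := by
  simp only [lineVec_comm R _ p, sum_lineVec]

/-- The complement of a line is the value set of the square of a linear form. -/
theorem one_sub_lineVec_mem (l : Line) : 1 - lineVec F3 l ∈ lineDiffCode := by
  -- Each point lies on 4 of the 13 lines, so the sum is 4 · 1 - 13 · l, and 4 = 13 = 1 in `F3`.
  have h : 1 - lineVec F3 l = ∑ m : Line, (lineVec F3 m - lineVec F3 l) := by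
    ext p
    have h4 : (4 : F3) = 1 := by decide
    have h13 : (13 : F3) = 1 := by decide
    simp [Finset.sum_apply, sum_lines, card_pt, h4, h13]
  rw [h]
  exact Submodule.sum_mem _ fun m _ => Submodule.subset_span ⟨m, l, rfl⟩

/-- Six points of the plane that impose independent conditions on conics. -/
def conicPt (i : Fin 6) : Fin 3 → F3 :=
  ![![1, 0, 0], ![0, 1, 0], ![0, 0, 1], ![1, 1, 0], ![1, 0, 1], ![0, 1, 1]] i

theorem conicPt_ne_zero (i : Fin 6) : conicPt i ≠ 0 := by
  revert i; unfold conicPt; decide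

theorem one_sub_lineVec_mk {v w : Fin 3 → F3} (hv : v ≠ 0) (hw : w ≠ 0) :
    (1 - lineVec F3 (.mk F3 v hv)) (.mk F3 w hw) = (∑ i, w i * v i) ^ 2 := by
  classical
  have h : (Projectivization.mk F3 w hw ∈ Line.points (.mk F3 v hv)) ↔ ∑ i, w i * v i = 0 :=
    Projectivization.orthogonal_mk hw hv
  rw [Pi.sub_apply, lineVec_apply, Pi.one_apply]
  simp only [h]
  generalize ∑ i, w i * v i = x
  revert x
  decide

/-- The values at the six points of the squares of the corresponding linear forms. -/
def conicGram : Matrix (Fin 6) (Fin 6) F3 := fun i j => (∑ k, conicPt j k * conicPt i k) ^ 2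

theorem linearIndependent_conicGram : LinearIndependent F3 conicGram := by
  refine Matrix.linearIndependent_rows_of_isUnit (A := conicGram) ?_
  -- The explicit inverse of the matrix modulo 3.
  refine IsUnit.of_mul_eq_one (!![2, 2, 2, 1, 1, 0; 2, 2, 2, 1, 0, 1; 2, 2, 2, 0, 1, 1;
    1, 1, 0, 2, 0, 0; 1, 0, 1, 0, 2, 0; 0, 1, 1, 0, 0, 2] : Matrix (Fin 6) (Fin 6) F3) ?_
  unfold conicGram conicPt
  decide +kernel

/-- Six complements of lines, seen as squares of linear forms, are independent because their values
at six points form an invertible matrix. -/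
theorem six_le_finrank_lineDiffCode : 6 ≤ Module.finrank F3 lineDiffCode := by
  let Q (i : Fin 6) : lineDiffCode := ⟨_, one_sub_lineVec_mem (.mk F3 _ (conicPt_ne_zero i))⟩
  let T : lineDiffCode →ₗ[F3] Fin 6 → F3 :=
    LinearMap.funLeft F3 F3 (fun j => Projectivization.mk F3 _ (conicPt_ne_zero j)) ∘ₗ
      lineDiffCode.subtype
  have hT : T ∘ Q = conicGram := by
    ext i j
    exact one_sub_lineVec_mk (conicPt_ne_zero i) (conicPt_ne_zero j)
  have hQ : LinearIndependent F3 Q :=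
    LinearIndependent.of_comp T (hT ▸ linearIndependent_conicGram)
  simpa using hQ.fintype_card_le_finrank

theorem lineCode_eq_orthogonal :
    lineCode = (Matrix.toBilin' (1 : Matrix Pt Pt F3)).orthogonal lineDiffCode := by
  ext c
  simp only [LinearMap.BilinForm.mem_orthogonal_iff, Matrix.toBilin'_apply',
    Matrix.one_mulVec, dotProduct_comm _ c]
  rfl

theorem finrank_lineCode : Module.finrank F3 lineCode = 13 - Module.finrank F3 lineDiffCode := by
  rw [lineCode_eq_orthogonal, LinearMap.BilinForm.finrank_orthogonal
    (LinearMap.BilinForm.nondegenerate_toBilin'_of_det_ne_zero' _ (by simp))]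
  simp [card_pt]

/-- The line code is spanned by the lines. -/
theorem lineSpan_eq_lineCode : lineSpan = lineCode := by
  refine Submodule.eq_of_le_of_finrank_le lineSpan_le_lineCode ?_
  have h := Submodule.finrank_lt_finrank_of_lt lineDiffCode_lt_lineSpan
  have := six_le_finrank_lineDiffCode
  have := finrank_lineCode
  omega

theorem exists_sum_lines {c : Pt → F3} (hc : c ∈ lineCode) :
    ∃ a : Line → F3, ∀ p, c p = ∑ l, a l * lineVec F3 l p := by
  rw [← lineSpan_eq_lineCode, lineSpan, Submodule.mem_span_range_iff_exists_fun] at hc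
  obtain ⟨a, rfl⟩ := hc
  exact ⟨a, fun p => by simp⟩

/-! ### Eisenstein integers -/

theorem θ_eq : θ = 1 + 2 * ω := by
  rw [θ, conj_ω]; ring

theorem θ_mul_θ : θ * θ = -3 := by
  rw [θ_eq]; linear_combination 4 * ω_sq

theorem θ_ne_zero : θ ≠ 0 := fun h => by
  have := θ_mul_θ
  rw [h] at this
  norm_num at this

theorem conj_θ : conj θ = -θ := by simp [θ]

theorem mem_Eis_iff {z : ℂ} : z ∈ Eis ↔ ∃ a b : ℤ, z = a + b * ω := by
  constructor
  · intro h
    induction h using Algebra.adjoin_induction with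
    | mem x hx => exact ⟨0, 1, by rw [Set.mem_singleton_iff.1 hx]; simp⟩
    | algebraMap r => exact ⟨r, 0, by simp⟩
    | add x y _ _ hx hy =>
      obtain ⟨a, b, rfl⟩ := hx
      obtain ⟨c, d, rfl⟩ := hy
      exact ⟨a + c, b + d, by push_cast; ring⟩
    | mul x y _ _ hx hy =>
      obtain ⟨a, b, rfl⟩ := hx
      obtain ⟨c, d, rfl⟩ := hy
      exact ⟨a * c - b * d, a * d + b * c - b * d, by
        push_cast; linear_combination (b * d : ℂ) * ω_sq⟩
  · rintro ⟨a, b, rfl⟩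
    exact Eis.add_mem (intCast_mem _ _) (Eis.mul_mem (intCast_mem _ _) ω_mem)

theorem conj_mem {z : ℂ} (h : z ∈ Eis) : conj z ∈ Eis := by
  obtain ⟨a, b, rfl⟩ := mem_Eis_iff.1 h
  refine mem_Eis_iff.2 ⟨a - b, -b, ?_⟩
  simp only [map_add, map_mul, conj_ω, map_intCast]
  push_cast; ring

theorem θ_mem : θ ∈ Eis := Eis.sub_mem ω_mem (conj_mem ω_mem)

theorem congrModθ_symm {x y : ℂ} (h : CongrModθ x y) : CongrModθ y x := by
  obtain ⟨e, he, h⟩ := h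
  exact ⟨-e, Eis.neg_mem he, by linear_combination -h⟩

theorem CongrModθ.trans {x y z : ℂ} (h : CongrModθ x y) (h' : CongrModθ y z) : CongrModθ x z := by
  obtain ⟨e, he, h⟩ := h
  obtain ⟨f, hf, h'⟩ := h'
  exact ⟨e + f, Eis.add_mem he hf, by linear_combination h + h'⟩

theorem CongrModθ.mul_left {x y a : ℂ} (ha : a ∈ Eis) (h : CongrModθ x y) :
    CongrModθ (a * x) (a * y) := by
  obtain ⟨e, he, h⟩ := h
  exact ⟨a * e, Eis.mul_mem ha he, by linear_combination a * h⟩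

theorem CongrModθ.sum {ι : Type*} (s : Finset ι) {f g : ι → ℂ} (h : ∀ i ∈ s, CongrModθ (f i) (g i)) :
    CongrModθ (∑ i ∈ s, f i) (∑ i ∈ s, g i) := by
  choose! e he h using h
  exact ⟨∑ i ∈ s, e i, Eis.sum_mem he, by
    rw [← Finset.sum_sub_distrib, Finset.mul_sum]; exact Finset.sum_congr rfl h⟩

/-- This is θℰ ∩ ℤ = 3ℤ: a multiple θ(a + bω) = (a - 2b) + (2a - b)ω is real only if b = 2a, and
then it equals -3a. Conversely 3 = -θ². -/
theorem congrModθ_intCast_iff {m n : ℤ} : CongrModθ m n ↔ (m : F3) = n := by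
  rw [← sub_eq_zero, ← Int.cast_sub, ZMod.intCast_zmod_eq_zero_iff_dvd]
  constructor
  · rintro ⟨e, he, h⟩
    obtain ⟨a, b, rfl⟩ := mem_Eis_iff.1 he
    replace h : (m : ℂ) - n = (a - 2 * b) + (2 * a - b) * ω := by
      rw [h, θ_eq]; linear_combination (2 * b : ℂ) * ω_sq
    have him := congrArg Complex.im h
    have hre := congrArg Complex.re h
    simp only [ω, Complex.sub_im, Complex.intCast_im, Complex.add_im, Complex.mul_im,
      Complex.sub_re, Complex.mul_re, Complex.re_ofNat, Complex.intCast_re, Complex.im_ofNat,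
      Complex.add_re] at him hre
    have h3 : Real.sqrt 3 ≠ 0 := by positivity
    have hb : (2 * a - b : ℝ) = 0 := by
      refine (mul_eq_zero.1 (?_ : (2 * a - b : ℝ) * √3 = 0)).resolve_right h3
      linarith
    refine ⟨-a, ?_⟩
    have : (m - n : ℝ) = 3 * -a := by linarith
    exact_mod_cast this
  · rintro ⟨k, hk⟩
    have hk : (m : ℂ) - n = 3 * k := by exact_mod_cast hk
    exact ⟨-θ * k, Eis.mul_mem (Eis.neg_mem θ_mem) (intCast_mem _ _), by
      linear_combination hk + k * θ_mul_θ⟩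

/-- Division with remainder by an Eisenstein integer of smaller norm. -/
theorem exists_normSq_sub_lt_one (z : ℂ) : ∃ e ∈ Eis, Complex.normSq (z - e) < 1 := by
  have h3 : Real.sqrt 3 * Real.sqrt 3 = 3 := Real.mul_self_sqrt (by norm_num)
  -- Write z = s + tω with s, t real and round both. The remainder x + yω has norm x² - xy + y² ≤
  -- 3/4.
  set t : ℝ := z.im / (Real.sqrt 3 / 2) with ht
  have him : z.im = t * (Real.sqrt 3 / 2) := by rw [ht]; field_simp
  set s : ℝ := z.re + t / 2 with hs
  refine ⟨round s + round t * ω, mem_Eis_iff.2 ⟨_, _, rfl⟩, ?_⟩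
  have h1 := abs_sub_round s
  have h2 := abs_sub_round t
  rw [abs_le] at h1 h2
  have : Complex.normSq (z - (round s + round t * ω)) =
      (s - round s) ^ 2 - (s - round s) * (t - round t) + (t - round t) ^ 2 := by
    rw [Complex.normSq_apply]
    simp [ω, him, hs]
    linear_combination (1 / 4 * (t - round t) ^ 2) * h3
  rw [this]
  generalize s - round s = x at *
  generalize t - round t = y at *
  nlinarith

theorem exists_normSq_eq {z : ℂ} (h : z ∈ Eis) : ∃ n : ℕ, Complex.normSq z = n := by
  obtain ⟨a, b, rfl⟩ := mem_Eis_iff.1 h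
  have h3 : Real.sqrt 3 * Real.sqrt 3 = 3 := Real.mul_self_sqrt (by norm_num)
  have : 0 ≤ a ^ 2 - a * b + b ^ 2 := by nlinarith [sq_nonneg (a - b), sq_nonneg (a + b)]
  refine ⟨(a ^ 2 - a * b + b ^ 2).toNat, ?_⟩
  rw [← Int.cast_natCast, Int.toNat_of_nonneg this, Complex.normSq_apply]
  simp [ω]
  linear_combination (1 / 4 * (b : ℝ) ^ 2) * h3

/-- Euclid's argument: a nonzero element of least norm generates the ideal. It supplies a basis for
the finite torsion-free module `model`. -/
instance : IsPrincipalIdealRing Eis := by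
  refine ⟨fun I => ?_⟩
  by_cases hI : I = ⊥
  · subst hI; infer_instance
  obtain ⟨x, hx, hx0⟩ := Submodule.exists_mem_ne_zero_of_ne_bot hI
  choose N hN using fun z : Eis => exists_normSq_eq z.2
  have hex : ∃ n, ∃ x ∈ I, x ≠ 0 ∧ N x = n := ⟨_, x, hx, hx0, rfl⟩
  classical
  obtain ⟨g, hg, hg0, hgn⟩ := Nat.find_spec hex
  have hmin : ∀ y ∈ I, y ≠ 0 → N g ≤ N y := fun y hy hy0 =>
    hgn ▸ Nat.find_min' hex ⟨y, hy, hy0, rfl⟩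
  have hg0' : (g : ℂ) ≠ 0 := by simpa using hg0
  refine ⟨⟨g, le_antisymm (fun y hy => ?_) ?_⟩⟩
  · obtain ⟨e, he, hlt⟩ := exists_normSq_sub_lt_one (y / g : ℂ)
    let r : Eis := y - ⟨e, he⟩ * g
    have hr : r ∈ I := I.sub_mem hy (I.mul_mem_left _ hg)
    have hr0 : r = 0 := by
      by_contra hr0
      have h1 := hmin r hr hr0
      have h2 : Complex.normSq r = Complex.normSq (y / g - e) * Complex.normSq g := by
        rw [← Complex.normSq_mul]
        congr 1
        simp only [r]
        push_cast
        field_simp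
      have h3 : 0 < Complex.normSq (g : ℂ) := Complex.normSq_pos.2 hg0'
      have h4 : Complex.normSq (r : ℂ) < Complex.normSq (g : ℂ) := by rw [h2]; nlinarith
      rw [hN, hN] at h4
      exact absurd (by exact_mod_cast h4) (not_lt.2 h1)
    exact Submodule.mem_span_singleton.2 ⟨⟨e, he⟩, by
      rw [smul_eq_mul]; exact (sub_eq_zero.1 hr0).symm⟩
  · rw [Submodule.span_le]
    simpa using hg

/-! ### Membership in the lattice -/

theorem intCast_lineVec (R : Type*) [CommRing R] (l : Line) (p : Pt) :
    ((lineVec ℤ l p : ℤ) : R) = lineVec R l p := by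
  classical
  rw [lineVec_apply, lineVec_apply]
  split_ifs <;> simp

theorem lineVec_mem_Eis (l : Line) (p : Pt) : lineVec ℂ l p ∈ Eis := by
  rw [← intCast_lineVec]; exact intCast_mem _ _

theorem CongrModθ.mul_right {x y a : ℂ} (ha : a ∈ Eis) (h : CongrModθ x y) :
    CongrModθ (x * a) (y * a) := by
  rw [mul_comm x, mul_comm y]; exact h.mul_left ha

/-- Equal line sums modulo θ say exactly that the reduction is orthogonal to differences of lines;
the congruence for the total sum comes from averaging over the lines through a point. -/
theorem mem_model_of_line_sums {x : C14} (h0 : x.1 ∈ Eis) (hp : ∀ p, x.2 p ∈ Eis)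
    (hl : ∀ l, CongrModθ x.1 (∑ p, x.2 p * lineVec ℂ l p)) : x ∈ model := by
  refine ⟨h0, hp, ?_, ?_⟩
  · choose n hn using fun p => exists_int_congr (hp p)
    refine ⟨fun p => (n p : F3), mem_lineCode_iff.2 fun l m => ?_, fun p => ⟨n p, rfl, hn p⟩⟩
    have h (l : Line) : CongrModθ x.1 ((∑ p, n p * lineVec ℤ l p : ℤ) : ℂ) := by
      refine (hl l).trans ?_
      push_cast
      simp only [intCast_lineVec]
      exact CongrModθ.sum _ fun p _ => (hn p).mul_right (lineVec_mem_Eis l p)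
    have := congrModθ_intCast_iff.1 ((congrModθ_symm (h l)).trans (h m))
    push_cast at this
    simpa only [intCast_lineVec] using this
  · obtain ⟨p⟩ : Nonempty Pt := inferInstance
    -- The 4 lines through p cover p four times and every other point once, so 4x₀ ≡ ∑ x_q + 3x_p.
    -- The multiples of 3 drop out because 3 = -θ².
    have h := CongrModθ.sum Finset.univ fun l _ => (hl l).mul_right (lineVec_mem_Eis l p)
    have h2 : ∑ l : Line, (∑ q, x.2 q * lineVec ℂ l q) * lineVec ℂ l p =
        ∑ q, x.2 q + 3 * x.2 p := by
      simp only [Finset.sum_mul]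
      rw [Finset.sum_comm]
      simp only [mul_assoc, ← Finset.mul_sum, sum_lines_mul]
      have (q : Pt) : x.2 q * (if q = p then (4 : ℂ) else 1) =
          x.2 q + if q = p then 3 * x.2 q else 0 := by split_ifs <;> ring
      simp [this, Finset.sum_add_distrib]
    rw [h2, ← Finset.mul_sum, sum_lines] at h
    obtain ⟨e, he, h⟩ := h
    refine ⟨e + θ * (x.1 - x.2 p),
      Eis.add_mem he (Eis.mul_mem θ_mem (Eis.sub_mem h0 (hp p))), ?_⟩
    linear_combination h - (x.1 - x.2 p) * θ_mul_θ

theorem form_apply (x y : C14) : form x y = -(x.1 * conj y.1) + ∑ p, x.2 p * conj (y.2 p) := rfl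

theorem form_pointRoot (p : Pt) (y : C14) : form (pointRoot p) y = θ * conj (y.2 p) := by
  simp [form_apply, pointRoot, Pi.single_apply]

theorem form_lineRoot (l : Line) (y : C14) :
    form (lineRoot l) y = -conj y.1 + ∑ p, lineVec ℂ l p * conj (y.2 p) := by
  simp [form_apply, lineRoot]

theorem form_hermitian : IsHermitianForm form := by
  intro x y
  simp [form_apply, mul_comm]

theorem pointRoot_mem (p : Pt) : pointRoot p ∈ model := by
  refine mem_model_of_line_sums Eis.zero_mem (fun q => ?_) fun l => ?_
  · simp only [pointRoot, Pi.single_apply]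
    split_ifs
    exacts [θ_mem, Eis.zero_mem]
  · exact ⟨-lineVec ℂ l p, Eis.neg_mem (lineVec_mem_Eis l p), by
      simp [pointRoot, Pi.single_apply]⟩

theorem lineRoot_mem (l : Line) : lineRoot l ∈ model := by
  refine mem_model_of_line_sums Eis.one_mem (lineVec_mem_Eis l) fun m => ?_
  simp only [lineRoot, sum_lineVec_mul]
  split_ifs
  · exact ⟨θ, θ_mem, by rw [θ_mul_θ]; norm_num⟩
  · exact ⟨0, Eis.zero_mem, by simp⟩

theorem form_pointRoot_self (p : Pt) : form (pointRoot p) (pointRoot p) = 3 := by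
  rw [form_pointRoot]
  simp [pointRoot, conj_θ, θ_mul_θ]

theorem conj_lineVec (l : Line) (p : Pt) : conj (lineVec ℂ l p) = lineVec ℂ l p := by
  rw [← intCast_lineVec, map_intCast]

theorem form_lineRoot_lineRoot (l m : Line) :
    form (lineRoot l) (lineRoot m) = if l = m then 3 else 0 := by
  rw [form_lineRoot]
  simp only [lineRoot, conj_lineVec, sum_lineVec_mul]
  split_ifs <;> norm_num

theorem pointRoot_injective : Function.Injective pointRoot := by
  intro p q h
  by_contra hne
  have h := congrFun (congrArg Prod.snd h) p
  simp [pointRoot, hne, θ_ne_zero] at h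

theorem lineRoot_injective : Function.Injective lineRoot := fun _ _ h =>
  lineVec_injective ℂ (congrArg Prod.snd h)

/-! ### Generation by the roots -/

/-- The `ℤ[ω]`-span of the point roots and the line roots. -/
def rootSpan : Submodule Eis C14 :=
  Submodule.span Eis (Set.range pointRoot ∪ Set.range lineRoot)

theorem pointRoot_mem_rootSpan (p : Pt) : pointRoot p ∈ rootSpan :=
  Submodule.subset_span (.inl ⟨p, rfl⟩)

theorem lineRoot_mem_rootSpan (l : Line) : lineRoot l ∈ rootSpan :=
  Submodule.subset_span (.inr ⟨l, rfl⟩)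

theorem rootSpan_le_model : rootSpan ≤ model := by
  refine Submodule.span_le.2 ?_
  rintro _ (⟨p, rfl⟩ | ⟨l, rfl⟩)
  exacts [pointRoot_mem p, lineRoot_mem l]

theorem Eis_smul_fst (a : Eis) (x : C14) : (a • x).1 = (a : ℂ) * x.1 := rfl

theorem Eis_smul_snd (a : Eis) (x : C14) (p : Pt) : (a • x).2 p = (a : ℂ) * x.2 p := rfl

/-- One line root, scaled by θa, gives coordinate 0; point roots then correct the other coordinates.
-/
theorem mul_θ_mem_rootSpan {a : ℂ} {f : Pt → ℂ} (ha : a ∈ Eis) (hf : ∀ p, f p ∈ Eis) :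
    ((θ * a, fun p => θ * f p) : C14) ∈ rootSpan := by
  obtain ⟨l⟩ : Nonempty Line := inferInstance
  have h : ((θ * a, fun p => θ * f p) : C14) = (⟨θ * a, Eis.mul_mem θ_mem ha⟩ : Eis) • lineRoot l +
      ∑ p, (⟨f p - a * lineVec ℂ l p,
        Eis.sub_mem (hf p) (Eis.mul_mem ha (lineVec_mem_Eis l p))⟩ : Eis) • pointRoot p := by
    ext p
    · simp only [Prod.fst_add, Prod.fst_sum, Eis_smul_fst, lineRoot, pointRoot, mul_zero, mul_one,
        Finset.sum_const_zero, add_zero]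
    · simp only [Prod.snd_add, Pi.add_apply, Prod.snd_sum, Finset.sum_apply, Eis_smul_snd, lineRoot,
        pointRoot, Pi.single_apply, mul_ite, mul_zero, Finset.sum_ite_eq, Finset.mem_univ, if_true]
      ring
  rw [h]
  exact add_mem (Submodule.smul_mem _ _ (lineRoot_mem_rootSpan l))
    (Submodule.sum_mem _ fun p _ => Submodule.smul_mem _ _ (pointRoot_mem_rootSpan p))

theorem model_le_rootSpan : model ≤ rootSpan := by
  intro x hx
  obtain ⟨-, -, ⟨c, hc, hxc⟩, -⟩ := id hx
  obtain ⟨a, ha⟩ := exists_sum_lines hc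
  choose n hn using fun l => ZMod.intCast_surjective (a l)
  let s : C14 := ∑ l, n l • lineRoot l
  have hs : s ∈ rootSpan :=
    Submodule.sum_mem _ fun l _ => zsmul_mem (lineRoot_mem_rootSpan l) _
  -- Since x - s lies in L and its last 13 coordinates are divisible by θ, this congruence makes
  -- coordinate 0 divisible by θ as well.
  obtain ⟨-, -, -, h0⟩ := sub_mem hx (rootSpan_le_model hs)
  have hp (p : Pt) : CongrModθ ((x - s).2 p) 0 := by
    obtain ⟨m, hm, hxm⟩ := hxc p
    have h1 : s.2 p = ((∑ l, n l * lineVec ℤ l p : ℤ) : ℂ) := by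
      simp [s, Prod.snd_sum, Finset.sum_apply, lineRoot, intCast_lineVec]
    have h2 : CongrModθ m ((∑ l, n l * lineVec ℤ l p : ℤ) : ℂ) := by
      rw [congrModθ_intCast_iff, hm, ha p]
      push_cast
      simp only [hn, intCast_lineVec]
    obtain ⟨e, he, h⟩ := hxm.trans h2
    exact ⟨e, he, by rw [Prod.snd_sub, Pi.sub_apply, h1, h, sub_zero]⟩
  choose f hf hfe using hp
  obtain ⟨e, he, hee⟩ := h0
  have hmem := mul_θ_mem_rootSpan (Eis.add_mem he (Eis.sum_mem fun p (_ : p ∈ Finset.univ) => hf p)) hf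
  have hy : x - s = (θ * (e + ∑ p, f p), fun p => θ * f p) := by
    simp only [sub_zero] at hfe
    ext p
    · simp only [hfe, ← Finset.mul_sum] at hee
      linear_combination hee
    · exact hfe p
  rw [← hy] at hmem
  simpa using add_mem hmem hs

theorem rootSpan_eq_model : rootSpan = model :=
  le_antisymm rootSpan_le_model model_le_rootSpan

/-! ### Duality -/

theorem congrModθ_zero_iff {z : ℂ} : CongrModθ z 0 ↔ ∃ e ∈ Eis, z = θ * e := by
  simp [CongrModθ]

theorem form_congr_zero_of_roots {x y : C14} (hx : x ∈ Set.range pointRoot ∪ Set.range lineRoot)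
    (hy : y ∈ Set.range pointRoot ∪ Set.range lineRoot) : CongrModθ (form x y) 0 := by
  rw [congrModθ_zero_iff]
  rcases hx with ⟨p, rfl⟩ | ⟨l, rfl⟩
  · have : y ∈ model := by
      rcases hy with ⟨p, rfl⟩ | ⟨l, rfl⟩
      exacts [pointRoot_mem p, lineRoot_mem l]
    exact ⟨_, conj_mem (this.2.1 p), form_pointRoot p y⟩
  · rcases hy with ⟨p, rfl⟩ | ⟨m, rfl⟩
    · refine ⟨-lineVec ℂ l p, Eis.neg_mem (lineVec_mem_Eis l p), ?_⟩
      rw [← form_hermitian, form_pointRoot, lineRoot, map_mul, conj_θ]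
      simp [conj_lineVec]
    · rw [form_lineRoot_lineRoot]
      split_ifs
      · exact ⟨-θ, Eis.neg_mem θ_mem, by linear_combination θ_mul_θ⟩
      · exact ⟨0, Eis.zero_mem, by simp⟩

theorem CongrModθ.add {x y z w : ℂ} (h : CongrModθ x y) (h' : CongrModθ z w) :
    CongrModθ (x + z) (y + w) := by
  obtain ⟨e, he, h⟩ := h
  obtain ⟨f, hf, h'⟩ := h'
  exact ⟨e + f, Eis.add_mem he hf, by linear_combination h + h'⟩

theorem form_smul_right (a : ℂ) (x y : C14) : form x (a • y) = conj a * form x y :=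
  LinearMap.map_smulₛₗ (form x) a y

theorem form_congr_zero {x y : C14} (hx : x ∈ model) (hy : y ∈ model) :
    CongrModθ (form x y) 0 := by
  rw [← rootSpan_eq_model] at hx hy
  have h0 : CongrModθ 0 0 := ⟨0, Eis.zero_mem, by simp⟩
  induction hx, hy using Submodule.span_induction₂ with
  | mem_mem x y hx hy => exact form_congr_zero_of_roots hx hy
  | zero_left y _ => simpa using h0
  | zero_right x _ => simpa using h0
  | add_left x y z _ _ _ h1 h2 => simpa using h1.add h2
  | add_right x y z _ _ _ h1 h2 => simpa using h1.add h2
  | smul_left a x y _ _ h =>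
    have : form (a • x) y = a * form x y := LinearMap.map_smul₂ form (a : ℂ) x y
    rw [this]
    simpa using h.mul_left a.2
  | smul_right a x y _ _ h =>
    have : form x (a • y) = conj (a : ℂ) * form x y := form_smul_right a x y
    rw [this]
    simpa using h.mul_left (conj_mem a.2)

theorem model_eq_θ_smul_dual : (model : Set C14) = θ • dual form model := by
  ext y
  rw [Set.mem_smul_set]
  constructor
  · intro hy
    refine ⟨θ⁻¹ • y, fun x hx => ?_, smul_inv_smul₀ θ_ne_zero y⟩
    obtain ⟨e, he, h⟩ := congrModθ_zero_iff.1 (form_congr_zero hx hy)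
    rw [form_smul_right, h, map_inv₀, conj_θ]
    have : (-θ)⁻¹ * (θ * e) = -e := by field_simp [θ_ne_zero]
    rw [this]
    exact Eis.neg_mem he
  · rintro ⟨v, hv, rfl⟩
    have hp (p : Pt) : (θ • v).2 p ∈ Eis := by
      have := conj_mem (hv _ (pointRoot_mem p))
      rw [form_pointRoot, map_mul, conj_θ, Complex.conj_conj] at this
      have h := Eis.neg_mem this
      rwa [neg_mul, neg_neg] at h
    have hl (l : Line) : CongrModθ (θ • v).1 (∑ p, (θ • v).2 p * lineVec ℂ l p) := by
      refine ⟨_, Eis.neg_mem (conj_mem (hv _ (lineRoot_mem l))), ?_⟩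
      rw [form_lineRoot]
      simp only [Prod.smul_fst, Prod.smul_snd, Pi.smul_apply, smul_eq_mul, map_add, map_neg,
        Complex.conj_conj, map_sum, map_mul, conj_lineVec, mul_assoc, ← Finset.mul_sum,
        mul_comm (lineVec ℂ l _)]
      ring
    refine mem_model_of_line_sums ?_ hp hl
    -- No root isolates coordinate 0; its integrality comes from its congruence to an integral line
    -- sum.
    obtain ⟨l⟩ : Nonempty Line := inferInstance
    obtain ⟨e, he, h⟩ := hl l
    rw [sub_eq_iff_eq_add.1 h]
    exact Eis.add_mem (Eis.mul_mem θ_mem he)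
      (Eis.sum_mem fun p _ => Eis.mul_mem (hp p) (lineVec_mem_Eis l p))

/-! ### Freeness and signature -/

theorem span_complex_rootSpan : Submodule.span ℂ (rootSpan : Set C14) = ⊤ := by
  refine eq_top_iff.2 fun x _ => ?_
  have h0 : ((1, 0) : C14) = θ⁻¹ • (θ * 1, fun _ => θ * 0) := by
    ext <;> simp [θ_ne_zero]
  have hs : x = x.1 • (1, 0) + ∑ p, (x.2 p * θ⁻¹) • pointRoot p := by
    ext p
    · simp [Prod.fst_sum, pointRoot]
    · simp [Prod.snd_sum, Finset.sum_apply, pointRoot, Pi.single_apply, θ_ne_zero]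
  rw [hs, h0]
  refine add_mem (Submodule.smul_mem _ _ (Submodule.smul_mem _ _ (Submodule.subset_span ?_)))
    (Submodule.sum_mem _ fun p _ => Submodule.smul_mem _ _
      (Submodule.subset_span (pointRoot_mem_rootSpan p)))
  exact mul_θ_mem_rootSpan Eis.one_mem fun _ => Eis.zero_mem

theorem finrank_C14 : Module.finrank ℂ C14 = 14 := by
  rw [Module.finrank_prod, Module.finrank_self, Module.finrank_pi, card_pt]

/-- The coordinates of a vector of the lattice, as Eisenstein integers. -/
def modelCoord : model →ₗ[Eis] Eis × (Pt → Eis) where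
  toFun x := (⟨x.1.1, x.2.1⟩, fun p => ⟨x.1.2 p, x.2.2.1 p⟩)
  map_add' _ _ := rfl
  map_smul' _ _ := rfl

theorem modelCoord_injective : Function.Injective modelCoord := by
  intro x y h
  refine Subtype.ext (Prod.ext ?_ (funext fun p => ?_))
  · exact congrArg (fun z => (z.1 : ℂ)) h
  · exact congrArg (fun z => (z.2 p : ℂ)) h

theorem model_free : ∃ (n : ℕ) (b : Module.Basis (Fin n) ℂ C14),
    model = Submodule.span Eis (Set.range b) := by
  have : Module.IsTorsionFree Eis model :=
    modelCoord_injective.moduleIsTorsionFree _ modelCoord.map_smul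
  have : Module.Finite Eis model := Module.Finite.of_injective modelCoord modelCoord_injective
  let b := Module.finBasis Eis model
  have hn : Module.finrank Eis model ≤ 14 := by
    have h := LinearMap.finrank_le_finrank_of_injective modelCoord_injective
    rwa [Module.finrank_prod, Module.finrank_self, Module.finrank_pi, card_pt] at h
  let v (i) : C14 := b i
  have hv : model = Submodule.span Eis (Set.range v) := by
    have h := congrArg (Submodule.map model.subtype) b.span_eq
    rw [Submodule.map_span, ← Set.range_comp, Submodule.map_top, Submodule.range_subtype] at h
    exact h.symm
  have hspan : ⊤ ≤ Submodule.span ℂ (Set.range v) := by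
    rw [← span_complex_rootSpan, rootSpan_eq_model, Submodule.span_le]
    exact (SetLike.coe_subset_coe.2 hv.le).trans (Submodule.span_subset_span Eis ℂ _)
  -- At most 14 vectors span ℂ^14, so an ℰ-basis of L is already a ℂ-basis.
  have hli : LinearIndependent ℂ v :=
    linearIndependent_of_top_le_span_of_card_le_finrank hspan (by rwa [finrank_C14, Fintype.card_fin])
  exact ⟨_, Module.Basis.mk hli hspan, by rw [Module.Basis.coe_mk]; exact hv⟩

theorem form_signature : HasSignature form 13 1 := by
  let e : Pt ≃ Fin 13 := Fintype.equivFinOfCardEq card_pt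
  let b : Module.Basis (Fin 13 ⊕ Fin 1) ℂ C14 :=
    ((Module.Basis.singleton (Fin 1) ℂ).prod ((Pi.basisFun ℂ Pt).reindex e)).reindex
      (Equiv.sumComm _ _)
  have hl (i) : b (.inl i) = (0, Pi.single (e.symm i) 1) := by
    simp [b, Module.Basis.prod_apply]
  have hr (j) : b (.inr j) = (1, 0) := by
    simp [b, Module.Basis.prod_apply]
  refine ⟨b, fun i => ?_, fun j => ?_, ?_⟩
  · rw [hl, form_apply]; simp [Pi.single_apply]
  · rw [hr, form_apply]; simp
  · rintro (i | i) (j | j) h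
    · have : j ≠ i := fun h' => h (by rw [h'])
      rw [hl, hl, form_apply]; simp [Pi.single_apply, this]
    · rw [hl, hr, form_apply]; simp
    · rw [hl, hr, form_apply]; simp
    · exact absurd (by rw [Subsingleton.elim i j]) h

theorem model_isL131 : IsL131 form model where
  lattice :=
    { hermitian := form_hermitian
      free := model_free
      integral := fun x hx y hy => by
        obtain ⟨e, he, h⟩ := congrModθ_zero_iff.1 (form_congr_zero hx hy)
        exact h ▸ Eis.mul_mem θ_mem he }
  signature := form_signature
  eq_theta_dual := model_eq_θ_smul_dual

end EisensteinModel

end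

theorem theorem4 :
    EisensteinModel.IsL131 EisensteinModel.form EisensteinModel.model ∧
    (Set.range EisensteinModel.pointRoot).ncard = 13 ∧
    (Set.range EisensteinModel.lineRoot).ncard = 13 ∧
    (∀ l, (EisensteinModel.Line.points l).ncard = 4) ∧
    (∀ p, EisensteinModel.IsRoot EisensteinModel.form EisensteinModel.model
      (EisensteinModel.pointRoot p)) ∧
    (∀ l, EisensteinModel.IsRoot EisensteinModel.form EisensteinModel.model
      (EisensteinModel.lineRoot l)) ∧
    Submodule.span EisensteinModel.Eis
      (Set.range EisensteinModel.pointRoot ∪ Set.range EisensteinModel.lineRoot) =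
      EisensteinModel.model := by
  refine ⟨EisensteinModel.model_isL131, ?_, ?_, EisensteinModel.ncard_points,
    fun p => ⟨EisensteinModel.pointRoot_mem p, EisensteinModel.form_pointRoot_self p⟩,
    fun l => ⟨EisensteinModel.lineRoot_mem l, ?_⟩, EisensteinModel.rootSpan_eq_model⟩
  · rw [← Set.image_univ, Set.ncard_image_of_injective _ EisensteinModel.pointRoot_injective,
      Set.ncard_univ, Nat.card_eq_fintype_card, EisensteinModel.card_pt]
  · rw [← Set.image_univ, Set.ncard_image_of_injective _ EisensteinModel.lineRoot_injective,
      Set.ncard_univ, Nat.card_eq_fintype_card, EisensteinModel.card_pt]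
  · rw [EisensteinModel.form_lineRoot_lineRoot, if_pos rfl]
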